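/- Let $\mathbb{T}=\mathbb{R}^2/\mathbb{Z}^2$ be the flat torus. Let $\Gamma$ be a geodesic toroidal triangulation: an embedding in $\mathbb{T}$ of a finite graph, in which loops and parallel edges are allowed, such that the vertices are distinct points of $\mathbb{T}$, every edge is the projection of a line segment of $\mathbb{R}^2$, edges meet (each other or themselves) only at vertices and contain no vertices other than their endpoints, and every face of the preimage of $\Gamma$ in the universal cover $\mathbb{R}^2$ is a triangle bounded by three lifted edges. The degree of a vertex counts every loop at that vertex twice. Call $\Gamma$ a zipper if every vertex of $\Gamma$ is incident to a loop. Then: 1. If every vertex of $\Gamma$ has degree $6$ and $\Gamma$ contains a loop, then $\Gamma$ is a zipper. 2. Every vertex of $\Gamma$ that is incident to a loop has degree at least $6$. 3. If $\Gamma$ contains a loop but is not a zipper, then $\Gamma$ has a vertex of degree at most $5$ that is not incident to a loop. In particular, if $\Gamma$ is not a zipper, then $\Gamma$ has a vertex of degree at most $5$ or contains no loop. -/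

import Mathlib

/-- A multigraph (loops and parallel edges allowed) given by its darts: every edge is a pair
`{d, rev d}` of opposite darts, and each dart has a tail. -/
structure DartGraph (V D : Type*) where
  tail : D → V
  rev : D → D
  rev_rev : ∀ d, rev (rev d) = d
  rev_ne : ∀ d, rev d ≠ d

namespace DartGraph

variable {V D : Type*} (G : DartGraph V D)

/-- The head of a dart is the tail of its reversal. -/
def head (d : D) : V := G.tail (G.rev d)

/-- A dart is (half of) a loop if its head and its tail coincide. -/
def IsLoop (d : D) : Prop := G.head d = G.tail d

/-- The graph contains a loop. -/
def HasLoop : Prop := ∃ d, G.IsLoop d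

/-- The vertex `v` is incident to a loop. -/
def IncidentToLoop (v : V) : Prop := ∃ d, G.IsLoop d ∧ G.tail d = v

/-- The degree of `v`: the number of darts leaving `v`, so that every loop at `v` counts twice. -/
noncomputable def degree (v : V) : ℕ := {d : D | G.tail d = v}.ncard

end DartGraph

/-- The torus `ℝ² / ℤ²`. -/
abbrev FlatTorus : Type := UnitAddCircle × UnitAddCircle

/-- The covering map `ℝ² → ℝ² / ℤ²`. -/
def torusProj (z : ℝ × ℝ) : FlatTorus := ((z.1 : UnitAddCircle), (z.2 : UnitAddCircle))

/-- A drawing of `G` on the torus with geodesic edges, not yet required to be injective.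
The dart `d` is drawn as the geodesic that starts at its tail and has displacement `disp d`,
i.e. as the projection of any segment `[w, w + disp d]` where `w` lies over the tail of `d`. -/
structure GeodesicDrawing {V D : Type*} (G : DartGraph V D) where
  pos : V → FlatTorus
  disp : D → ℝ × ℝ
  disp_rev : ∀ d, disp (G.rev d) = -disp d
  pos_head : ∀ d, pos (G.head d) = pos (G.tail d) + torusProj (disp d)

namespace GeodesicDrawing

variable {V D : Type*} {G : DartGraph V D} (Γ : GeodesicDrawing G)

/-- The geodesic parametrization, for `t ∈ [0, 1]`, of the dart `d`. -/
noncomputable def edgePoint (d : D) (t : ℝ) : FlatTorus :=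
  Γ.pos (G.tail d) + torusProj (t • Γ.disp d)

/-- The drawing is an embedding: distinct vertices are distinct points, no vertex lies in the
relative interior of an edge, edges do not intersect themselves, and distinct edges have
disjoint relative interiors. -/
structure IsEmbedding : Prop where
  pos_injective : Function.Injective Γ.pos
  edge_ne_pos : ∀ d, ∀ t ∈ Set.Ioo (0 : ℝ) 1, ∀ v, Γ.edgePoint d t ≠ Γ.pos v
  edge_injective : ∀ d d', ∀ t ∈ Set.Ioo (0 : ℝ) 1, ∀ t' ∈ Set.Ioo (0 : ℝ) 1,
    Γ.edgePoint d t = Γ.edgePoint d' t' →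
      (d' = d ∧ t' = t) ∨ (d' = G.rev d ∧ t' = 1 - t)

/-- The image of the graph in the torus. -/
def image : Set FlatTorus :=
  Set.range Γ.pos ∪ ⋃ d, Γ.edgePoint d '' Set.Icc (0 : ℝ) 1

/-- The image of the universal cover of the drawing in the plane. -/
def coverImage : Set (ℝ × ℝ) := torusProj ⁻¹' Γ.image

/-- The segment from `a` to `b` is a lift of the dart `d` to the universal cover. -/
def IsLift (d : D) (a b : ℝ × ℝ) : Prop :=
  torusProj a = Γ.pos (G.tail d) ∧ b = a + Γ.disp d

/-- A geodesic toroidal triangulation: a geodesic embedding whose universal cover is a planar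
triangulation, i.e. every face of the universal cover (every connected component of the
complement of the lifted graph) is an open triangle bounded by lifts of three darts. The triangle
is automatically nondegenerate, since its interior contains `z`. -/
structure IsTriangulation : Prop extends Γ.IsEmbedding where
  face_triangle : ∀ z ∉ Γ.coverImage, ∃ (d₀ d₁ d₂ : D) (a b c : ℝ × ℝ),
    Γ.IsLift d₀ a b ∧ Γ.IsLift d₁ b c ∧ Γ.IsLift d₂ c a ∧
      connectedComponentIn Γ.coverImageᶜ z = interior (convexHull ℝ {a, b, c})

/-- A zipper: a geodesic toroidal triangulation in which every vertex is incident to a loop. -/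
structure IsZipper : Prop extends Γ.IsTriangulation where
  incidentToLoop : ∀ v, G.IncidentToLoop v

end GeodesicDrawing

/-! A loop `ℓ` at `v` has a triangle on each side. The other two sides of each triangle both end at
`v`, so they give two more darts at `v` strictly left of `ℓ` and two strictly right. With the two
darts of `ℓ` this makes degree at least 6 (`exists_six_darts`).

If the degree is exactly 6, only two darts leave `v` on each side of `ℓ`. They are consecutive in
the cyclic order and end at the same vertex, so the third side of the triangle between them is a
loop there (`LeftFace.incidentToLoop_head`). Hence loops spread from a vertex to its neighbours, and
since the graph is connected (`mem_of_forall_head_mem`) they reach every vertex.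

The third claim needs average degree at most 6 (`card_dart_le`), obtained without Euler's formula by
counting the middle corners of the faces for a generic height. If every vertex of degree at most 5
had a loop, there would be no such vertex, all degrees would be 6, and the graph would be a zipper.

The geometric input is that every dart has a triangle on its left (`exists_leftFace`) and that no
dart enters the angle of a triangle (`false_of_between`). -/

/-- The determinant of two plane vectors. -/
def planeDet (p q : ℝ × ℝ) : ℝ := p.1 * q.2 - p.2 * q.1

/-- The open triangle with vertices `a`, `a + p`, `a + q`. -/
def openTri (a p q : ℝ × ℝ) : Set (ℝ × ℝ) :=
  {z | ∃ s t : ℝ, 0 < s ∧ 0 < t ∧ s + t < 1 ∧ z = a + (s • p + t • q)}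

/-- The closed triangle with vertices `a`, `a + p`, `a + q`. -/
def closedTri (a p q : ℝ × ℝ) : Set (ℝ × ℝ) :=
  {z | ∃ s t : ℝ, 0 ≤ s ∧ 0 ≤ t ∧ s + t ≤ 1 ∧ z = a + (s • p + t • q)}

/-! ### Plane determinants and triangles. -/

theorem eq_combination_of_planeDet_ne_zero {p q : ℝ × ℝ} (h : planeDet p q ≠ 0) (x : ℝ × ℝ) :
    x = (planeDet x q / planeDet p q) • p + (planeDet p x / planeDet p q) • q := by
  unfold planeDet at *
  ext <;> simp only [Prod.fst_add, Prod.snd_add, Prod.smul_fst, Prod.smul_snd, smul_eq_mul] <;>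
    rw [div_mul_eq_mul_div, div_mul_eq_mul_div, ← add_div, eq_div_iff h] <;> ring

/-- The vector `c` puts `p` and `q` in one open half-plane, which rules out opposite directions. -/
theorem exists_pos_smul_of_planeDet_eq_zero {c p q : ℝ × ℝ} (h : planeDet p q = 0)
    (hp : 0 < planeDet c p) (hq : 0 < planeDet c q) : ∃ r : ℝ, 0 < r ∧ q = r • p := by
  refine ⟨planeDet c q / planeDet c p, by positivity, ?_⟩
  unfold planeDet at *
  ext <;> simp <;> field_simp
  · linear_combination (-c.1) * h
  · linear_combination (-c.2) * h

theorem openTri_subset_closedTri (a p q : ℝ × ℝ) : openTri a p q ⊆ closedTri a p q := by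
  rintro z ⟨s, t, hs, ht, hst, rfl⟩
  exact ⟨s, t, hs.le, ht.le, hst.le, rfl⟩

theorem openTri_swap (a p q : ℝ × ℝ) : openTri a p q = openTri a q p := by
  ext z
  constructor <;>
  · rintro ⟨s, t, hs, ht, hst, rfl⟩
    exact ⟨t, s, ht, hs, by linarith, by rw [add_comm (s • _)]⟩

theorem convexHull_triple_eq_closedTri (a p q : ℝ × ℝ) :
    convexHull ℝ {a, a + p, a + q} = closedTri a p q := by
  rw [convexHull_insert (by simp), convexHull_pair]
  ext z
  simp only [mem_convexJoin, Set.mem_singleton_iff, exists_eq_left]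
  constructor
  · rintro ⟨y, ⟨u, v, hu, hv, huv, rfl⟩, ⟨u', v', hu', hv', huv', rfl⟩⟩
    refine ⟨v' * u, v' * v, by positivity, by positivity, ?_, ?_⟩
    · nlinarith
    · obtain rfl : u = 1 - v := by linarith
      obtain rfl : u' = 1 - v' := by linarith
      ext <;> simp <;> ring
  · rintro ⟨s, t, hs, ht, hst, rfl⟩
    rcases eq_or_ne (s + t) 0 with h0 | h0
    · obtain rfl : s = 0 := by linarith
      obtain rfl : t = 0 := by linarith
      exact ⟨a + p, left_mem_segment ℝ _ _, by simpa using left_mem_segment ℝ a (a + p)⟩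
    · have h1 : 0 < s + t := lt_of_le_of_ne (by positivity) h0.symm
      refine ⟨(s / (s + t)) • (a + p) + (t / (s + t)) • (a + q),
        ⟨_, _, by positivity, by positivity, by field_simp, rfl⟩,
        1 - (s + t), s + t, by linarith, h1.le, by ring, ?_⟩
      ext <;> simp <;> field_simp <;> ring

theorem isCompact_closedTri (a p q : ℝ × ℝ) : IsCompact (closedTri a p q) := by
  rw [← convexHull_triple_eq_closedTri]
  exact Set.Finite.isCompact_convexHull (𝕜 := ℝ) (Set.toFinite _)

theorem convex_openTri (a p q : ℝ × ℝ) : Convex ℝ (openTri a p q) := by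
  rintro _ ⟨s, t, hs, ht, hst, rfl⟩ _ ⟨s', t', hs', ht', hst', rfl⟩ u v hu hv huv
  have key : ∀ x y : ℝ, 0 < x → 0 < y → 0 < u * x + v * y := fun x y hx hy ↦ by
    rcases hu.eq_or_lt with rfl | hu
    · obtain rfl : v = 1 := by linarith
      simpa using hy
    · positivity
  refine ⟨u * s + v * s', u * t + v * t', key _ _ hs hs', key _ _ ht ht', ?_, ?_⟩
  · nlinarith [key (1 - s - t) (1 - s' - t') (by linarith) (by linarith)]
  · obtain rfl : u = 1 - v := by linarith
    ext <;> simp <;> ring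

theorem isOpen_openTri {a p q : ℝ × ℝ} (h : planeDet p q ≠ 0) : IsOpen (openTri a p q) := by
  have : openTri a p q =
      {z | 0 < planeDet (z - a) q / planeDet p q} ∩ {z | 0 < planeDet p (z - a) / planeDet p q} ∩
      {z | planeDet (z - a) q / planeDet p q + planeDet p (z - a) / planeDet p q < 1} := by
    ext z
    constructor
    · rintro ⟨s, t, hs, ht, hst, rfl⟩
      have h1 : planeDet (a + (s • p + t • q) - a) q / planeDet p q = s := by
        rw [div_eq_iff h]; simp [planeDet]; ring
      have h2 : planeDet p (a + (s • p + t • q) - a) / planeDet p q = t := by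
        rw [div_eq_iff h]; simp [planeDet]; ring
      simp only [Set.mem_inter_iff, Set.mem_ofPred_eq, h1, h2]
      exact ⟨⟨hs, ht⟩, hst⟩
    · rintro ⟨⟨h1, h2⟩, h3⟩
      exact ⟨_, _, h1, h2, h3, by
        rw [← eq_combination_of_planeDet_ne_zero h (z - a), add_sub_cancel]⟩
  rw [this]
  unfold planeDet
  refine ((isOpen_lt ?_ ?_).inter (isOpen_lt ?_ ?_)).inter (isOpen_lt ?_ ?_) <;> fun_prop

/-- From an interior point one can move in every direction `x`. If `p` and `q` were parallel, every
`x` would be parallel to both, so both would vanish and the triangle would be a point. -/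
theorem planeDet_ne_zero_of_mem_interior {a p q z : ℝ × ℝ}
    (hz : z ∈ interior (closedTri a p q)) : planeDet p q ≠ 0 := by
  intro h
  have key : ∀ x : ℝ × ℝ, planeDet p x = 0 ∧ planeDet q x = 0 := fun x ↦ by
    have hc : Filter.Tendsto (fun r : ℝ ↦ z + r • x) (nhds 0) (nhds z) := by
      have : Continuous (fun r : ℝ ↦ z + r • x) := by fun_prop
      simpa using this.tendsto 0
    obtain ⟨s, t, -, -, -, hst⟩ := interior_subset hz
    obtain ⟨r, hr, hr0⟩ := (((hc.mono_left nhdsWithin_le_nhds).eventually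
      (mem_interior_iff_mem_nhds.1 hz)).and
        (self_mem_nhdsWithin (a := (0 : ℝ)) (s := Set.Ioi 0))).exists
    obtain ⟨s', t', -, -, -, hst'⟩ := hr
    rw [hst] at hst'
    have e1 := congrArg Prod.fst hst'
    have e2 := congrArg Prod.snd hst'
    simp at e1 e2
    have hr0 : (r : ℝ) ≠ 0 := ne_of_gt hr0
    unfold planeDet at *
    constructor <;> refine (mul_eq_zero_iff_left hr0).1 ?_
    · linear_combination p.1 * e2 - p.2 * e1 + (t' - t) * h
    · linear_combination q.1 * e2 - q.2 * e1 - (s' - s) * h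
  obtain ⟨h1, h2⟩ := key (1, 0)
  obtain ⟨h3, h4⟩ := key (0, 1)
  have hp : p = 0 := by ext <;> simp_all [planeDet]
  have hq : q = 0 := by ext <;> simp_all [planeDet]
  subst hp hq
  have : closedTri a 0 0 ⊆ {a} := by
    rintro _ ⟨s, t, -, -, -, rfl⟩
    simp
  simpa using interior_mono this hz

theorem interior_closedTri {a p q : ℝ × ℝ} (h : planeDet p q ≠ 0) :
    interior (closedTri a p q) = openTri a p q := by
  refine subset_antisymm (fun z hz ↦ ?_)
    (interior_maximal (openTri_subset_closedTri a p q) (isOpen_openTri h))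
  have key : ∀ x : ℝ × ℝ, ∃ r : ℝ, 0 < r ∧ z + r • x ∈ closedTri a p q := fun x ↦ by
    have hc : Filter.Tendsto (fun r : ℝ ↦ z + r • x) (nhds 0) (nhds z) := by
      have : Continuous (fun r : ℝ ↦ z + r • x) := by fun_prop
      simpa using this.tendsto 0
    obtain ⟨r, hr, hr0⟩ := (((hc.mono_left nhdsWithin_le_nhds).eventually
      (mem_interior_iff_mem_nhds.1 hz)).and
        (self_mem_nhdsWithin (a := (0 : ℝ)) (s := Set.Ioi 0))).exists
    exact ⟨r, hr0, hr⟩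
  have uniq : ∀ s t s' t' : ℝ, s • p + t • q = s' • p + t' • q → s = s' ∧ t = t' := by
    intro s t s' t' e
    have e1 := congrArg Prod.fst e
    have e2 := congrArg Prod.snd e
    simp at e1 e2
    unfold planeDet at h
    constructor <;> refine mul_right_cancel₀ h ?_
    · linear_combination q.2 * e1 - q.1 * e2
    · linear_combination p.1 * e2 - p.2 * e1
  obtain ⟨s, t, -, -, -, rfl⟩ := interior_subset hz
  -- Moving along `-p`, `-q` and `p` makes the three weak inequalities on the coordinates strict.
  obtain ⟨r, hr, s', t', hs', -, -, e⟩ := key (-p)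
  obtain ⟨r2, hr2, s2, t2, -, ht2, -, e2⟩ := key (-q)
  obtain ⟨r3, hr3, s3, t3, -, -, hst3, e3⟩ := key p
  have := uniq (s - r) t s' t' (by
    rw [add_assoc] at e; rw [← add_left_cancel e]; module)
  have := uniq s (t - r2) s2 t2 (by
    rw [add_assoc] at e2; rw [← add_left_cancel e2]; module)
  have := uniq (s + r3) t s3 t3 (by
    rw [add_assoc] at e3; rw [← add_left_cancel e3]; module)
  exact ⟨s, t, by linarith, by linarith, by linarith, rfl⟩

/-- A point of a closed triangle outside the open triangle is on one of the three sides. -/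
theorem mem_sides_of_mem_closedTri {a p q z : ℝ × ℝ} (hz : z ∈ closedTri a p q)
    (hz' : z ∉ openTri a p q) : ∃ r ∈ Set.Icc (0 : ℝ) 1,
      z = a + r • p ∨ z = a + p + r • (q - p) ∨ z = a + q + r • (-q) := by
  obtain ⟨s, t, hs, ht, hst, rfl⟩ := hz
  rcases hs.eq_or_lt with rfl | hs
  · exact ⟨1 - t, ⟨by linarith, by linarith⟩, Or.inr (Or.inr (by module))⟩
  rcases ht.eq_or_lt with rfl | ht
  · exact ⟨s, ⟨by linarith, by linarith⟩, Or.inl (by module)⟩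
  rcases hst.eq_or_lt with h | hst
  · obtain rfl : s = 1 - t := by linarith
    exact ⟨t, ⟨by linarith, by linarith⟩, Or.inr (Or.inl (by module))⟩
  · exact absurd ⟨s, t, hs, ht, hst, rfl⟩ hz'

theorem left_mem_closure_openTri (a p q : ℝ × ℝ) : a ∈ closure (openTri a p q) := by
  have hc : Filter.Tendsto (fun r : ℝ ↦ a + (r • p + r • q)) (nhdsWithin 0 (Set.Ioi 0))
      (nhds a) := by
    have : Continuous (fun r : ℝ ↦ a + (r • p + r • q)) := by fun_prop
    simpa using (this.tendsto 0).mono_left nhdsWithin_le_nhds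
  refine mem_closure_of_tendsto hc ?_
  filter_upwards [Ioo_mem_nhdsGT (show (0 : ℝ) < 1 / 2 by norm_num)] with r hr
  exact ⟨r, r, hr.1, hr.1, by linarith [hr.2], rfl⟩

/-! ### The covering map of the torus. -/

theorem torusProj_add (a b : ℝ × ℝ) : torusProj (a + b) = torusProj a + torusProj b := by
  simp [torusProj]

theorem torusProj_zero : torusProj 0 = 0 := by
  simp [torusProj]

theorem torusProj_sub (a b : ℝ × ℝ) : torusProj (a - b) = torusProj a - torusProj b := by
  simp [torusProj]

theorem continuous_torusProj : Continuous torusProj := by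
  unfold torusProj
  exact ((AddCircle.continuous_mk' 1).comp continuous_fst).prodMk
    ((AddCircle.continuous_mk' 1).comp continuous_snd)

theorem torusProj_surjective : Function.Surjective torusProj := by
  rintro ⟨x, y⟩
  obtain ⟨a, rfl⟩ := QuotientAddGroup.mk_surjective x
  obtain ⟨b, rfl⟩ := QuotientAddGroup.mk_surjective y
  exact ⟨(a, b), rfl⟩

theorem eq_zero_of_torusProj_eq_zero {x : ℝ × ℝ} (hx : ‖x‖ < 1) (h : torusProj x = 0) :
    x = 0 := by
  have key : ∀ y : ℝ, ‖y‖ < 1 → (y : UnitAddCircle) = 0 → y = 0 := fun y hy h ↦ by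
    obtain ⟨n, hn⟩ := (AddCircle.coe_eq_zero_iff (1 : ℝ)).1 h
    simp only [zsmul_eq_mul, mul_one] at hn
    subst hn
    rw [Real.norm_eq_abs] at hy
    have : |n| < 1 := by exact_mod_cast hy
    simp [Int.abs_lt_one_iff.1 this]
  exact Prod.ext (key _ ((norm_fst_le x).trans_lt hx) (congrArg Prod.fst h))
    (key _ ((norm_snd_le x).trans_lt hx) (congrArg Prod.snd h))

/-! ### Darts and the triangles on their left. -/

namespace DartGraph

variable {V D : Type*} (G : DartGraph V D)

theorem head_rev (d : D) : G.head (G.rev d) = G.tail d := by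
  rw [head, G.rev_rev]

theorem tail_rev (d : D) : G.tail (G.rev d) = G.head d := rfl

theorem rev_injective : Function.Injective G.rev :=
  Function.Involutive.injective G.rev_rev

end DartGraph

namespace GeodesicDrawing

variable {V D : Type*} {G : DartGraph V D} {Γ : GeodesicDrawing G}

/-- `d₀`, `d₁`, `d₂` bound, in counterclockwise order, a triangle whose interior is disjoint from
the drawing. -/
structure LeftFace (Γ : GeodesicDrawing G) (d₀ d₁ d₂ : D) : Prop where
  tail₁ : G.tail d₁ = G.head d₀
  tail₂ : G.tail d₂ = G.head d₁
  tail₀ : G.tail d₀ = G.head d₂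
  sum_disp : Γ.disp d₀ + Γ.disp d₁ + Γ.disp d₂ = 0
  planeDet_pos : 0 < planeDet (Γ.disp d₀) (Γ.disp d₁)
  notMem_image : ∀ s t : ℝ, 0 < s → 0 < t → s + t < 1 →
    Γ.pos (G.tail d₀) + torusProj (s • Γ.disp d₀ + t • (-Γ.disp d₂)) ∉ Γ.image

theorem edgePoint_zero (d : D) : Γ.edgePoint d 0 = Γ.pos (G.tail d) := by
  simp [edgePoint, torusProj_zero]

theorem edgePoint_one (d : D) : Γ.edgePoint d 1 = Γ.pos (G.head d) := by
  simp [edgePoint, Γ.pos_head]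

theorem edgePoint_rev (d : D) (t : ℝ) : Γ.edgePoint (G.rev d) t = Γ.edgePoint d (1 - t) := by
  rw [edgePoint, edgePoint, Γ.disp_rev, G.tail_rev, Γ.pos_head, add_assoc, ← torusProj_add]
  congr 2
  module

theorem continuous_edgePoint (d : D) : Continuous (Γ.edgePoint d) :=
  continuous_const.add (continuous_torusProj.comp (by fun_prop))

theorem edgePoint_mem_image (d : D) {t : ℝ} (ht : t ∈ Set.Icc (0 : ℝ) 1) :
    Γ.edgePoint d t ∈ Γ.image :=
  Or.inr (Set.mem_iUnion.2 ⟨d, t, ht, rfl⟩)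

namespace LeftFace

variable {d₀ d₁ d₂ : D}

theorem disp_two (h : Γ.LeftFace d₀ d₁ d₂) : Γ.disp d₂ = -Γ.disp d₀ - Γ.disp d₁ := by
  linear_combination h.sum_disp

theorem rotate (h : Γ.LeftFace d₀ d₁ d₂) : Γ.LeftFace d₁ d₂ d₀ where
  tail₁ := h.tail₂
  tail₂ := h.tail₀
  tail₀ := h.tail₁
  sum_disp := by rw [← h.sum_disp]; abel
  planeDet_pos := by
    have := h.planeDet_pos
    rw [h.disp_two]
    simp only [planeDet, Prod.fst_sub, Prod.snd_sub, Prod.fst_neg, Prod.snd_neg] at *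
    linarith
  notMem_image s t hs ht hst := by
    have := h.notMem_image (1 - s - t) s (by linarith) hs (by linarith)
    rw [h.tail₁, Γ.pos_head, add_assoc, ← torusProj_add]
    convert this using 4
    rw [h.disp_two]
    module

theorem planeDet_rev (h : Γ.LeftFace d₀ d₁ d₂) :
    0 < planeDet (Γ.disp d₀) (Γ.disp (G.rev d₂)) := by
  have := h.planeDet_pos
  rw [Γ.disp_rev, h.disp_two]
  simp only [planeDet, Prod.fst_sub, Prod.snd_sub, Prod.fst_neg, Prod.snd_neg] at *
  linarith

/-- No dart leaves the tail of `d₀` strictly between the two sides of the triangle there. -/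
theorem false_of_between (h : Γ.LeftFace d₀ d₁ d₂) {e : D} (he : G.tail e = G.tail d₀)
    (h₁ : 0 < planeDet (Γ.disp d₀) (Γ.disp e))
    (h₂ : 0 < planeDet (Γ.disp e) (Γ.disp (G.rev d₂))) : False := by
  have hd := h.planeDet_rev
  rw [Γ.disp_rev] at h₂ hd
  have key := eq_combination_of_planeDet_ne_zero hd.ne' (Γ.disp e)
  set α := planeDet (Γ.disp e) (-Γ.disp d₂) / planeDet (Γ.disp d₀) (-Γ.disp d₂)
  set β := planeDet (Γ.disp d₀) (Γ.disp e) / planeDet (Γ.disp d₀) (-Γ.disp d₂)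
  have hα : 0 < α := by positivity
  have hβ : 0 < β := by positivity
  -- At this parameter the point of `e` has coordinates with sum below 1, so it lies both on the
  -- drawing and in the open triangle.
  have hr : 0 < 1 / (1 + α + β) := by positivity
  refine h.notMem_image (1 / (1 + α + β) * α) (1 / (1 + α + β) * β) (by positivity)
    (by positivity) ?_ ?_
  · rw [← mul_add, one_div_mul_eq_div, div_lt_one (by positivity)]
    linarith
  · rw [mul_smul, mul_smul, ← smul_add, ← key, ← he]
    refine edgePoint_mem_image e ⟨hr.le, ?_⟩
    rw [div_le_one (by positivity)]
    linarith

theorem disjoint_coverImage (h : Γ.LeftFace d₀ d₁ d₂) {a : ℝ × ℝ}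
    (ha : torusProj a = Γ.pos (G.tail d₀)) {z : ℝ × ℝ}
    (hz : z ∈ openTri a (Γ.disp d₀) (-Γ.disp d₂)) : z ∉ Γ.coverImage := by
  obtain ⟨s, t, hs, ht, hst, rfl⟩ := hz
  change torusProj _ ∉ Γ.image
  rw [torusProj_add, ha]
  exact h.notMem_image s t hs ht hst

theorem exists_edgePoint (h : Γ.LeftFace d₀ d₁ d₂) {a : ℝ × ℝ}
    (ha : torusProj a = Γ.pos (G.tail d₀)) {z : ℝ × ℝ}
    (hz : z ∈ closedTri a (Γ.disp d₀) (-Γ.disp d₂))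
    (hz' : z ∉ openTri a (Γ.disp d₀) (-Γ.disp d₂)) :
    ∃ r ∈ Set.Icc (0 : ℝ) 1,
      (z = a + r • Γ.disp d₀ ∧ torusProj z = Γ.edgePoint d₀ r) ∨
      (z = a + Γ.disp d₀ + r • Γ.disp d₁ ∧ torusProj z = Γ.edgePoint d₁ r) ∨
      (z = a + Γ.disp d₀ + Γ.disp d₁ + r • Γ.disp d₂ ∧ torusProj z = Γ.edgePoint d₂ r) := by
  obtain ⟨r, hr, hz⟩ := mem_sides_of_mem_closedTri hz hz'
  refine ⟨r, hr, ?_⟩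
  have h₁ : -Γ.disp d₂ - Γ.disp d₀ = Γ.disp d₁ := by rw [h.disp_two]; abel
  have h₂ : a + -Γ.disp d₂ = a + Γ.disp d₀ + Γ.disp d₁ := by rw [h.disp_two]; abel
  rw [h₁, h₂, neg_neg] at hz
  rcases hz with rfl | rfl | rfl
  · exact Or.inl ⟨rfl, by rw [torusProj_add, ha, edgePoint]⟩
  · exact Or.inr (Or.inl ⟨rfl, by
      rw [torusProj_add, torusProj_add, ha, edgePoint, h.tail₁, Γ.pos_head]⟩)
  · exact Or.inr (Or.inr ⟨rfl, by
      rw [torusProj_add, torusProj_add, torusProj_add, ha, edgePoint, h.tail₂, Γ.pos_head, h.tail₁,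
        Γ.pos_head]⟩)

end LeftFace

/-- Every face of the universal cover is bounded counterclockwise by three lifted darts. -/
theorem IsTriangulation.exists_leftFace_of_notMem (hΓ : Γ.IsTriangulation) {z : ℝ × ℝ}
    (hz : z ∉ Γ.coverImage) : ∃ (d₀ d₁ d₂ : D) (a : ℝ × ℝ), Γ.LeftFace d₀ d₁ d₂ ∧
      torusProj a = Γ.pos (G.tail d₀) ∧
      connectedComponentIn Γ.coverImageᶜ z = openTri a (Γ.disp d₀) (-Γ.disp d₂) := by
  obtain ⟨d₀, d₁, d₂, a, b, c, ⟨ha, hb⟩, ⟨hb', hc⟩, ⟨hc', ha'⟩, hC⟩ := hΓ.face_triangle z hz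
  have hb2 : b = a + Γ.disp d₀ := hb
  have hc2 : c = a + -Γ.disp d₂ := by rw [ha']; abel
  have hsum : Γ.disp d₀ + Γ.disp d₁ + Γ.disp d₂ = 0 := by
    have : a = a + (Γ.disp d₀ + Γ.disp d₁ + Γ.disp d₂) := by
      conv_lhs => rw [ha', hc, hb]
      abel
    simpa using this
  have t₁ : G.tail d₁ = G.head d₀ := hΓ.pos_injective (by
    rw [← hb', hb, torusProj_add, ha, Γ.pos_head])
  have t₂ : G.tail d₂ = G.head d₁ := hΓ.pos_injective (by
    rw [← hc', hc, torusProj_add, hb', Γ.pos_head])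
  have t₀ : G.tail d₀ = G.head d₂ := hΓ.pos_injective (by
    rw [← ha, ha', torusProj_add, hc', Γ.pos_head])
  rw [hb2, hc2, convexHull_triple_eq_closedTri] at hC
  have hzC : z ∈ interior (closedTri a (Γ.disp d₀) (-Γ.disp d₂)) := by
    rw [← hC]
    exact mem_connectedComponentIn hz
  have hdet := planeDet_ne_zero_of_mem_interior hzC
  rw [interior_closedTri hdet] at hC
  have hdisj : ∀ s t : ℝ, 0 < s → 0 < t → s + t < 1 →
      Γ.pos (G.tail d₀) + torusProj (s • Γ.disp d₀ + t • (-Γ.disp d₂)) ∉ Γ.image := by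
    intro s t hs ht hst
    rw [← ha, ← torusProj_add]
    have : a + (s • Γ.disp d₀ + t • (-Γ.disp d₂)) ∈ connectedComponentIn Γ.coverImageᶜ z := by
      rw [hC]
      exact ⟨s, t, hs, ht, hst, rfl⟩
    exact connectedComponentIn_subset _ _ this
  have hd₁ : Γ.disp d₁ = -Γ.disp d₀ - Γ.disp d₂ := by
    linear_combination hsum
  -- A clockwise boundary is traversed backwards.
  rcases hdet.lt_or_gt with hneg | hpos
  · refine ⟨G.rev d₂, G.rev d₁, G.rev d₀, a, ⟨?_, ?_, ?_, ?_, ?_, ?_⟩, ?_, ?_⟩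
    · rw [G.tail_rev, G.head_rev, t₂]
    · rw [G.tail_rev, G.head_rev, t₁]
    · rw [G.tail_rev, G.head_rev, t₀]
    · simp only [Γ.disp_rev]
      linear_combination -hsum
    · simp only [Γ.disp_rev, hd₁]
      simp only [planeDet, Prod.fst_sub, Prod.snd_sub, Prod.fst_neg, Prod.snd_neg] at *
      linarith
    · intro s t hs ht hst
      have := hdisj t s ht hs (by linarith)
      rw [G.tail_rev, ← t₀, Γ.disp_rev, Γ.disp_rev, neg_neg, add_comm (s • _)]
      exact this
    · rw [G.tail_rev, ← t₀, ha]
    · rw [hC, Γ.disp_rev, Γ.disp_rev, neg_neg, openTri_swap]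
  · refine ⟨d₀, d₁, d₂, a, ⟨t₁, t₂, t₀, hsum, ?_, hdisj⟩, ha, hC⟩
    rw [hd₁]
    simp only [planeDet, Prod.fst_sub, Prod.snd_sub, Prod.fst_neg, Prod.snd_neg] at *
    linarith

/-! ### The drawing near the midpoint of an edge. -/

namespace IsEmbedding

theorem disp_ne_zero (hΓ : Γ.IsEmbedding) (d : D) : Γ.disp d ≠ 0 := fun h ↦
  hΓ.edge_ne_pos d (1 / 2) (by norm_num) (G.tail d) (by simp [edgePoint, h, torusProj_zero])

/-- Two darts that leave the same vertex in the same direction are equal. -/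
theorem eq_of_disp_eq_smul (hΓ : Γ.IsEmbedding) {d e : D} (ht : G.tail e = G.tail d) {r : ℝ}
    (hr : 0 < r) (h : Γ.disp e = r • Γ.disp d) : e = d := by
  -- The parameters `r / (2 + r)` on `d` and `1 / (2 + r)` on `e` give the same point. Their sum is
  -- below 1, which excludes `e = G.rev d`.
  have hpos : 0 < 1 / (2 + r) := by positivity
  have hlt : 1 / (2 + r) * (1 + r) < 1 := by
    rw [one_div_mul_eq_div, div_lt_one (by positivity)]
    linarith
  have h₁ : 1 / (2 + r) * r < 1 := by nlinarith
  rcases hΓ.edge_injective d e (1 / (2 + r) * r) ⟨by positivity, h₁⟩ (1 / (2 + r))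
    ⟨hpos, by nlinarith [mul_pos hpos hr]⟩ (by rw [edgePoint, edgePoint, h, ht, mul_smul]) with
    h' | h'
  · exact h'.1
  · nlinarith [h'.2]

/-- A point of the drawing in the relative interior of an edge is on that edge only. -/
theorem eq_or_eq_rev (hΓ : Γ.IsEmbedding) {d e : D} {t r : ℝ} (ht : t ∈ Set.Ioo (0 : ℝ) 1)
    (hr : r ∈ Set.Icc (0 : ℝ) 1) (h : Γ.edgePoint d t = Γ.edgePoint e r) :
    (e = d ∧ r = t) ∨ (e = G.rev d ∧ r = 1 - t) := by
  rcases hr.1.eq_or_lt with rfl | h0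
  · exact absurd (h.trans (edgePoint_zero e)) (hΓ.edge_ne_pos d t ht _)
  rcases hr.2.eq_or_lt with rfl | h1
  · exact absurd (h.trans (edgePoint_one e)) (hΓ.edge_ne_pos d t ht _)
  exact hΓ.edge_injective d e t ht r ⟨h0, h1⟩ h

/-- Points close to the midpoint of a lifted edge, but off its line, are not in the drawing. -/
theorem eventually_notMem_coverImage [Finite V] [Finite D] (hΓ : Γ.IsEmbedding) (d : D)
    {w n : ℝ × ℝ} (hw : torusProj w = Γ.pos (G.tail d)) (hn : planeDet (Γ.disp d) n ≠ 0) :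
    ∀ᶠ ε : ℝ in nhdsWithin 0 (Set.Ioi 0),
      w + (1 / 2 : ℝ) • Γ.disp d + ε • n ∉ Γ.coverImage := by
  have half : (1 / 2 : ℝ) ∈ Set.Ioo (0 : ℝ) 1 := by norm_num
  set m := w + (1 / 2 : ℝ) • Γ.disp d with hm
  have hmd : torusProj m = Γ.edgePoint d (1 / 2) := by rw [hm, torusProj_add, hw, edgePoint]
  have hcont : Filter.Tendsto (fun ε : ℝ ↦ torusProj (m + ε • n)) (nhdsWithin 0 (Set.Ioi 0))
      (nhds (torusProj m)) := by
    have : Continuous (fun ε : ℝ ↦ torusProj (m + ε • n)) :=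
      continuous_torusProj.comp (by fun_prop)
    simpa using (this.tendsto 0).mono_left nhdsWithin_le_nhds
  have hne : ∀ K : Set FlatTorus, IsClosed K → torusProj m ∉ K →
      ∀ᶠ ε : ℝ in nhdsWithin 0 (Set.Ioi 0), torusProj (m + ε • n) ∉ K := fun K hK hmK ↦
    hcont.eventually (hK.isOpen_compl.mem_nhds hmK)
  have hpos : ∀ᶠ ε : ℝ in nhdsWithin 0 (Set.Ioi 0), torusProj (m + ε • n) ∉ Set.range Γ.pos := by
    refine hne _ (Set.finite_range _).isClosed ?_
    rintro ⟨v, hv⟩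
    exact hΓ.edge_ne_pos d _ half v (hmd.symm.trans hv.symm)
  -- Within the window of radius `δ` about parameter `1 / 2`, displacements stay shorter than 1 even
  -- after adding `ε • n`, so equalities on the torus lift to the plane.
  obtain ⟨δ, hδ, hδ'⟩ : ∃ δ : ℝ, 0 < δ ∧ δ * ‖Γ.disp d‖ < 1 / 2 := by
    refine ⟨1 / (2 * (‖Γ.disp d‖ + 1)), by positivity, ?_⟩
    rw [one_div_mul_eq_div, div_lt_div_iff₀ (by positivity) (by norm_num)]
    nlinarith [norm_nonneg (Γ.disp d)]
  -- Outside that window, each edge is a compact set that misses the midpoint.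
  have hfar : ∀ᶠ ε : ℝ in nhdsWithin 0 (Set.Ioi 0),
      ∀ e, torusProj (m + ε • n) ∉ Γ.edgePoint e '' (Set.Icc 0 1 ∩ {t | e = d ∨ e = G.rev d →
        δ ≤ |1 / 2 - t|}) := by
    refine Filter.eventually_all.2 fun e ↦ hne _ ?_ ?_
    · refine ((isCompact_Icc.inter_right ?_).image (continuous_edgePoint e)).isClosed
      by_cases h : e = d ∨ e = G.rev d
      · simp only [h, forall_const]
        exact isClosed_le continuous_const (by fun_prop)
      · simp [h]
    · rintro ⟨t, ⟨ht, ht'⟩, het⟩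
      have := hΓ.eq_or_eq_rev half ht (hmd.symm.trans het.symm)
      have h2 := ht' (this.imp And.left And.left)
      have : t = 1 / 2 := by rcases this with h | h <;> linarith [h.2]
      rw [this] at h2
      simp at h2
      linarith
  have hsmall : ∀ᶠ ε : ℝ in nhdsWithin 0 (Set.Ioi 0), ‖ε • n‖ < 1 / 2 := by
    have : Continuous (fun ε : ℝ ↦ ‖ε • n‖) := by fun_prop
    have := (this.tendsto 0).mono_left (nhdsWithin_le_nhds (s := Set.Ioi (0 : ℝ)))
    simp only [zero_smul, norm_zero] at this
    exact this.eventually (gt_mem_nhds (by norm_num))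
  filter_upwards [hpos, hfar, hsmall, self_mem_nhdsWithin] with ε h₁ h₂ h₃ h₄ hmem
  have hd : ∀ t ∈ Set.Icc (0 : ℝ) 1, |1 / 2 - t| < δ →
      torusProj (m + ε • n) ≠ Γ.edgePoint d t := by
    intro t ht htδ he
    rw [edgePoint, ← hw, ← torusProj_add, ← sub_eq_zero, ← torusProj_sub] at he
    have e0 : m + ε • n - (w + t • Γ.disp d) = (1 / 2 - t) • Γ.disp d + ε • n := by
      rw [hm]; module
    rw [e0] at he
    have hz := eq_zero_of_torusProj_eq_zero (by
      refine (norm_add_le _ _).trans_lt ?_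
      rw [norm_smul, Real.norm_eq_abs]
      have := mul_le_mul_of_nonneg_right htδ.le (norm_nonneg (Γ.disp d))
      linarith) he
    have e1 := congrArg Prod.fst hz
    have e2 := congrArg Prod.snd hz
    simp only [Prod.fst_add, Prod.snd_add, Prod.smul_fst, Prod.smul_snd, smul_eq_mul,
      Prod.fst_zero, Prod.snd_zero] at e1 e2
    refine hn ((mul_eq_zero_iff_left (ne_of_gt (show (0 : ℝ) < ε from h₄))).1 ?_)
    unfold planeDet
    linear_combination (Γ.disp d).1 * e2 - (Γ.disp d).2 * e1
  rcases hmem with h | h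
  · exact h₁ h
  · obtain ⟨e, t, ht, het⟩ := Set.mem_iUnion.1 h
    have hcase : ¬(e = d ∨ e = G.rev d → δ ≤ |1 / 2 - t|) := fun hc ↦ h₂ e ⟨t, ⟨ht, hc⟩, het⟩
    rw [Classical.not_imp, not_le] at hcase
    obtain ⟨rfl | rfl, hlt⟩ := hcase
    · exact hd t ht hlt het.symm
    · refine hd (1 - t) ⟨by linarith [ht.2], by linarith [ht.1]⟩ ?_ ?_
      · rw [show 1 / 2 - (1 - t) = -(1 / 2 - t) by ring, abs_neg]
        exact hlt
      · rw [← het, edgePoint_rev]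

end IsEmbedding

/-- Every dart has a triangular face to its left. -/
theorem IsTriangulation.exists_leftFace [Finite V] [Finite D] (hΓ : Γ.IsTriangulation) (d : D) :
    ∃ d₁ d₂, Γ.LeftFace d d₁ d₂ := by
  have half : (1 / 2 : ℝ) ∈ Set.Ioo (0 : ℝ) 1 := by norm_num
  obtain ⟨w, hw⟩ := torusProj_surjective (Γ.pos (G.tail d))
  set p := Γ.disp d with hp
  have hp0 : p ≠ 0 := hΓ.toIsEmbedding.disp_ne_zero d
  -- The left normal of `p`.
  set n : ℝ × ℝ := (-p.2, p.1) with hn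
  have hdet : 0 < planeDet p n := by
    have : p.1 ≠ 0 ∨ p.2 ≠ 0 := by
      by_contra! h
      exact hp0 (Prod.ext h.1 h.2)
    simp only [planeDet, hn]
    rcases this with h | h <;>
      nlinarith [mul_self_pos.2 h, mul_self_nonneg p.1, mul_self_nonneg p.2]
  set m := w + (1 / 2 : ℝ) • p with hm
  have hmd : torusProj m = Γ.edgePoint d (1 / 2) := by rw [hm, torusProj_add, hw, edgePoint]
  obtain ⟨ε₀, hε₀, hε⟩ := mem_nhdsGT_iff_exists_Ioo_subset.1
    (hΓ.toIsEmbedding.eventually_notMem_coverImage d hw hdet.ne')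
  have hε₀ : 0 < ε₀ := hε₀
  set z := m + (ε₀ / 2) • n with hz
  have hzC : z ∉ Γ.coverImage := hε ⟨by positivity, by linarith⟩
  obtain ⟨d₀, d₁, d₂, a, hF, ha, hC⟩ := hΓ.exists_leftFace_of_notMem hzC
  -- The short open segment on the left of the midpoint is connected, so it lies in a single face,
  -- and the midpoint is on the boundary of that face.
  have hsub : ∀ ε ∈ Set.Ioo 0 ε₀, m + ε • n ∈ openTri a (Γ.disp d₀) (-Γ.disp d₂) := by
    intro ε hε'
    rw [← hC]
    have hpre : IsPreconnected ((fun ε : ℝ ↦ m + ε • n) '' Set.Ioo 0 ε₀) :=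
      isPreconnected_Ioo.image _ (by fun_prop)
    refine hpre.subset_connectedComponentIn (x := z) ⟨ε₀ / 2, ⟨by positivity, by linarith⟩, rfl⟩
      ?_ ⟨ε, hε', rfl⟩
    rintro _ ⟨ε', h', rfl⟩
    exact hε h'
  have hmcl : m ∈ closedTri a (Γ.disp d₀) (-Γ.disp d₂) := by
    have hc : Filter.Tendsto (fun ε : ℝ ↦ m + ε • n) (nhdsWithin 0 (Set.Ioi 0)) (nhds m) := by
      have : Continuous (fun ε : ℝ ↦ m + ε • n) := by fun_prop
      simpa using (this.tendsto 0).mono_left nhdsWithin_le_nhds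
    refine (isCompact_closedTri _ _ _).isClosed.mem_of_tendsto hc ?_
    filter_upwards [Ioo_mem_nhdsGT hε₀] with ε hε
    exact openTri_subset_closedTri _ _ _ (hsub ε hε)
  have hmC : m ∈ Γ.coverImage := by
    change torusProj m ∈ Γ.image
    rw [hmd]
    exact edgePoint_mem_image d (by norm_num)
  have hmo : m ∉ openTri a (Γ.disp d₀) (-Γ.disp d₂) := fun h ↦ hF.disjoint_coverImage ha h hmC
  -- A face with a given side whose interior contains `z` is to the left of `d`.
  have finish : ∀ (e₀ e₁ e₂ : D) (b : ℝ × ℝ) (r : ℝ), Γ.LeftFace e₀ e₁ e₂ →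
      r ∈ Set.Icc (0 : ℝ) 1 →
      m = b + r • Γ.disp e₀ → torusProj m = Γ.edgePoint e₀ r →
      0 < planeDet (Γ.disp e₀) (z - b) → e₀ = d := by
    intro e₀ e₁ e₂ b r hE hr hb hme hside
    rcases hΓ.toIsEmbedding.eq_or_eq_rev half hr (hmd.symm.trans hme) with h | ⟨rfl, -⟩
    · exact h.1
    · exfalso
      have : z - b = r • Γ.disp (G.rev d) + (ε₀ / 2) • n := by rw [hz, hb]; abel
      rw [this, Γ.disp_rev, ← hp] at hside
      have h2 : planeDet (-p) (r • -p + (ε₀ / 2) • n) = -(ε₀ / 2 * planeDet p n) := by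
        simp [planeDet]; ring
      rw [h2] at hside
      nlinarith [mul_pos hε₀ hdet]
  -- The determinants of `z` against the three sides are `t`, `1 - s - t` and `s` times a positive
  -- number, so `z` is left of whichever side contains `m`.
  obtain ⟨s, t, hs, ht, hst, hz'⟩ := hsub (ε₀ / 2) ⟨by positivity, by linarith⟩
  have hz' : z = a + (s • Γ.disp d₀ + t • (Γ.disp d₀ + Γ.disp d₁)) := by
    rw [hz, hz', hF.disp_two]; module
  have hpos := hF.planeDet_pos
  obtain ⟨r, hr, h | h | h⟩ := hF.exists_edgePoint ha hmcl hmo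
  · obtain rfl := finish d₀ d₁ d₂ a r hF hr h.1 h.2 (by
      have : planeDet (Γ.disp d₀) (z - a) = t * planeDet (Γ.disp d₀) (Γ.disp d₁) := by
        rw [hz']; simp [planeDet]; ring
      rw [this]; positivity)
    exact ⟨_, _, hF⟩
  · obtain rfl := finish d₁ d₂ d₀ _ r hF.rotate hr h.1 h.2 (by
      have : planeDet (Γ.disp d₁) (z - (a + Γ.disp d₀)) =
          (1 - s - t) * planeDet (Γ.disp d₀) (Γ.disp d₁) := by
        rw [hz']; simp [planeDet]; ring
      rw [this]; exact mul_pos (by linarith) hpos)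
    exact ⟨_, _, hF.rotate⟩
  · obtain rfl := finish d₂ d₀ d₁ _ r hF.rotate.rotate hr h.1 h.2 (by
      have : planeDet (Γ.disp d₂) (z - (a + Γ.disp d₀ + Γ.disp d₁)) =
          s * planeDet (Γ.disp d₀) (Γ.disp d₁) := by
        rw [hz', hF.disp_two]; simp [planeDet]; ring
      rw [this]; positivity)
    exact ⟨_, _, hF.rotate.rotate⟩

/-! ### Uniqueness of the triangle on the left. -/

namespace IsEmbedding

theorem eq_of_planeDet_eq_zero (hΓ : Γ.IsEmbedding) {d e : D} (ht : G.tail e = G.tail d)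
    {c : ℝ × ℝ} (h : planeDet (Γ.disp d) (Γ.disp e) = 0) (hd : 0 < planeDet c (Γ.disp d))
    (he : 0 < planeDet c (Γ.disp e)) : e = d := by
  obtain ⟨r, hr, h⟩ := exists_pos_smul_of_planeDet_eq_zero h hd he
  exact hΓ.eq_of_disp_eq_smul ht hr h

/-- Of the two third sides at the tail of `d`, the first one counterclockwise would enter the angle
of the other triangle unless they coincide. -/
theorem leftFace_unique (hΓ : Γ.IsEmbedding) {d d₁ d₂ e₁ e₂ : D} (hd : Γ.LeftFace d d₁ d₂)
    (he : Γ.LeftFace d e₁ e₂) : e₁ = d₁ ∧ e₂ = d₂ := by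
  have t₁ : G.tail (G.rev d₂) = G.tail d := hd.tail₀.symm
  have t₂ : G.tail (G.rev e₂) = G.tail d := he.tail₀.symm
  have h₂ : e₂ = d₂ := by
    rcases lt_trichotomy (planeDet (Γ.disp (G.rev d₂)) (Γ.disp (G.rev e₂))) 0 with h | h | h
    · refine (hd.false_of_between t₂ he.planeDet_rev ?_).elim
      unfold planeDet at *
      linarith
    · exact G.rev_injective
        (hΓ.eq_of_planeDet_eq_zero (t₂.trans t₁.symm) h hd.planeDet_rev he.planeDet_rev)
    · exact (he.false_of_between t₁ hd.planeDet_rev h).elim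
  subst h₂
  refine ⟨hΓ.eq_of_disp_eq_smul (he.tail₁.trans hd.tail₁.symm) one_pos ?_, rfl⟩
  rw [one_smul]
  have h1 := hd.sum_disp.trans he.sum_disp.symm
  exact (add_left_cancel (add_right_cancel h1)).symm

end IsEmbedding

/-! ### Vertices incident to a loop. -/

section Loops

variable {ℓ d₁ d₂ : D}

theorem LeftFace.tail_of_isLoop (h : Γ.LeftFace ℓ d₁ d₂) (hl : G.IsLoop ℓ) :
    G.tail d₁ = G.tail ℓ ∧ G.tail (G.rev d₂) = G.tail ℓ :=
  ⟨h.tail₁.trans hl, h.tail₀.symm⟩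

theorem LeftFace.ne_rev (h : Γ.LeftFace ℓ d₁ d₂) (hΓ : Γ.IsEmbedding) : d₁ ≠ G.rev d₂ :=
  fun h' ↦ hΓ.disp_ne_zero ℓ (by
    have := h.sum_disp
    rwa [h', Γ.disp_rev, neg_add_cancel_right] at this)

theorem _root_.DartGraph.IsLoop.rev (hl : G.IsLoop ℓ) : G.IsLoop (G.rev ℓ) := by
  rw [DartGraph.IsLoop, G.head_rev, G.tail_rev, hl]

/-- The two faces at a loop `ℓ` give six darts at its vertex. -/
theorem exists_six_darts [Finite V] [Finite D] [DecidableEq D] (hΓ : Γ.IsTriangulation)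
    (hl : G.IsLoop ℓ) :
    ∃ d₁ d₂ e₁ e₂, Γ.LeftFace ℓ d₁ d₂ ∧ Γ.LeftFace (G.rev ℓ) e₁ e₂ ∧
      (({ℓ, G.rev ℓ, d₁, G.rev d₂, e₁, G.rev e₂} : Finset D) : Set D) ⊆ {d | G.tail d = G.tail ℓ} ∧
      ({ℓ, G.rev ℓ, d₁, G.rev d₂, e₁, G.rev e₂} : Finset D).card = 6 := by
  obtain ⟨d₁, d₂, hd⟩ := hΓ.exists_leftFace ℓ
  obtain ⟨e₁, e₂, he⟩ := hΓ.exists_leftFace (G.rev ℓ)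
  refine ⟨d₁, d₂, e₁, e₂, hd, he, ?_, ?_⟩
  · have h₁ := hd.tail_of_isLoop hl
    have h₂ := he.tail_of_isLoop hl.rev
    have h₃ : G.tail (G.rev ℓ) = G.tail ℓ := hl
    intro x hx
    simp only [Finset.coe_insert, Finset.coe_singleton, Set.mem_insert_iff,
      Set.mem_singleton_iff] at hx
    rcases hx with rfl | rfl | rfl | rfl | rfl | rfl
    exacts [rfl, h₃, h₁.1, h₁.2, h₂.1.trans h₃, h₂.2.trans h₃]
  -- The sign of the determinant with `ℓ` separates the loop (zero), the left darts (positive) and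
  -- the right darts (negative).
  · have p₁ := hd.planeDet_pos
    have p₂ := hd.planeDet_rev
    have q₁ := he.planeDet_pos
    have q₂ := he.planeDet_rev
    have key : ∀ x : D, planeDet (Γ.disp (G.rev ℓ)) (Γ.disp x) =
        -planeDet (Γ.disp ℓ) (Γ.disp x) := fun x ↦ by
      rw [Γ.disp_rev]; simp [planeDet]; ring
    have z₀ : planeDet (Γ.disp ℓ) (Γ.disp ℓ) = 0 := by simp [planeDet]; ring
    have z₁ : planeDet (Γ.disp ℓ) (Γ.disp (G.rev ℓ)) = 0 := by
      rw [Γ.disp_rev]; simp [planeDet]; ring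
    rw [key] at q₁ q₂
    have ne : ∀ {x y : D}, planeDet (Γ.disp ℓ) (Γ.disp x) ≠ planeDet (Γ.disp ℓ) (Γ.disp y) →
        x ≠ y := fun h hxy ↦ h (by rw [hxy])
    have r₁ := hd.ne_rev hΓ.toIsEmbedding
    have r₂ := he.ne_rev hΓ.toIsEmbedding
    have r₀ := (G.rev_ne ℓ).symm
    repeat rw [Finset.card_insert_of_notMem]
    · simp
    all_goals
      simp only [Finset.mem_insert, Finset.mem_singleton, not_or]
    · exact r₂
    · exact ⟨ne (by linarith), ne (by linarith)⟩
    · exact ⟨r₁, ne (by linarith), ne (by linarith)⟩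
    · refine ⟨ne ?_, ne ?_, ne ?_, ne ?_⟩ <;> intro h <;> linarith
    · refine ⟨r₀, ne ?_, ne ?_, ne ?_, ne ?_⟩ <;> intro h <;> linarith

theorem six_le_degree [Finite V] [Finite D] (hΓ : Γ.IsTriangulation) {v : V}
    (hv : G.IncidentToLoop v) : 6 ≤ G.degree v := by
  classical
  obtain ⟨ℓ, hl, rfl⟩ := hv
  obtain ⟨d₁, d₂, e₁, e₂, -, -, hsub, hcard⟩ := exists_six_darts hΓ hl
  rw [← hcard, ← Set.ncard_coe_finset]
  exact Set.ncard_le_ncard hsub (Set.toFinite _)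

/-- If only two darts leave a loop `ℓ` to its left, then their common head has a loop. -/
theorem LeftFace.incidentToLoop_head [Finite V] [Finite D] (hΓ : Γ.IsTriangulation)
    (h : Γ.LeftFace ℓ d₁ d₂) (hl : G.IsLoop ℓ)
    (honly : ∀ e, G.tail e = G.tail ℓ → 0 < planeDet (Γ.disp ℓ) (Γ.disp e) →
      e = d₁ ∨ e = G.rev d₂) :
    G.IncidentToLoop (G.head d₁) := by
  obtain ⟨f₁, f₂, hf⟩ := hΓ.exists_leftFace (G.rev d₂)
  have ht : G.tail (G.rev f₂) = G.tail ℓ := hf.tail₀.symm.trans h.tail₀.symm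
  have hf₂ := hf.planeDet_rev
  have p₁ := h.planeDet_pos
  have p₂ := h.planeDet_rev
  have e₂ : Γ.disp (G.rev d₂) = Γ.disp ℓ + Γ.disp d₁ := by rw [Γ.disp_rev, h.disp_two]; abel
  -- If `G.rev f₂` were not left of `ℓ`, then `d₁` would lie strictly inside the angle of the face
  -- `f`.
  have hd₁ : G.rev f₂ = d₁ := by
    rcases lt_or_ge 0 (planeDet (Γ.disp ℓ) (Γ.disp (G.rev f₂))) with hpos | hneg
    · rcases honly _ ht hpos with h' | h'
      · exact h'
      · rw [h'] at hf₂
        simp [planeDet, mul_comm] at hf₂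
    · refine (hf.false_of_between (h.tail₁.trans (hl.trans h.tail₀)) ?_ ?_).elim
      · rw [e₂]
        simp only [planeDet, Prod.fst_add, Prod.snd_add] at *
        linarith
      · have p₃ : planeDet (Γ.disp (G.rev d₂)) (Γ.disp d₁) =
            planeDet (Γ.disp ℓ) (Γ.disp d₁) := by
          rw [e₂]; simp [planeDet]; ring
        have plucker : planeDet (Γ.disp ℓ) (Γ.disp (G.rev d₂)) *
            planeDet (Γ.disp d₁) (Γ.disp (G.rev f₂)) =
            planeDet (Γ.disp ℓ) (Γ.disp d₁) * planeDet (Γ.disp (G.rev d₂)) (Γ.disp (G.rev f₂)) -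
            planeDet (Γ.disp ℓ) (Γ.disp (G.rev f₂)) *
              planeDet (Γ.disp (G.rev d₂)) (Γ.disp d₁) := by
          unfold planeDet; ring
        refine pos_of_mul_pos_right ?_ p₂.le
        rw [plucker, p₃]
        nlinarith [mul_pos p₁ hf₂, mul_nonneg (neg_nonneg.2 hneg) p₁.le]
  -- The third side `f₁` joins the heads of `G.rev d₂` and `d₁`, which coincide.
  have ht₁ : G.tail f₁ = G.head d₁ := by
    rw [hf.tail₁, G.head_rev, h.tail₂]
  refine ⟨f₁, ?_, ht₁⟩
  rw [DartGraph.IsLoop, ht₁, ← hf.tail₂, ← G.head_rev f₂, hd₁]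

/-- The six darts exhaust the star of the vertex, so its neighbours are itself and the apexes of the
two triangles at `ℓ`. -/
theorem incidentToLoop_head_of_degree_eq_six [Finite V] [Finite D] (hΓ : Γ.IsTriangulation)
    {d : D} (hdeg : G.degree (G.tail d) = 6) (hd : G.IncidentToLoop (G.tail d)) :
    G.IncidentToLoop (G.head d) := by
  classical
  obtain ⟨ℓ, hl, hv⟩ := hd
  obtain ⟨d₁, d₂, e₁, e₂, hD, hE, hsub, hcard⟩ := exists_six_darts hΓ hl
  have hall : ∀ e, G.tail e = G.tail ℓ →
      e ∈ ({ℓ, G.rev ℓ, d₁, G.rev d₂, e₁, G.rev e₂} : Finset D) := by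
    have := Set.eq_of_subset_of_ncard_le hsub
      (by rw [Set.ncard_coe_finset, hcard, hv]; exact hdeg.le) (Set.toFinite _)
    intro e he
    rw [← Finset.mem_coe, this]
    exact he
  simp only [Finset.mem_insert, Finset.mem_singleton] at hall
  have q₁ := hE.planeDet_pos
  have q₂ := hE.planeDet_rev
  have p₁ := hD.planeDet_pos
  have p₂ := hD.planeDet_rev
  have key : ∀ x : D, planeDet (Γ.disp (G.rev ℓ)) (Γ.disp x) =
      -planeDet (Γ.disp ℓ) (Γ.disp x) := fun x ↦ by
    rw [Γ.disp_rev]; simp [planeDet]; ring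
  have z₀ : planeDet (Γ.disp ℓ) (Γ.disp ℓ) = 0 := by simp [planeDet]; ring
  have z₁ : planeDet (Γ.disp ℓ) (Γ.disp (G.rev ℓ)) = 0 := by
    rw [Γ.disp_rev]; simp [planeDet]; ring
  have hD₁ := hD.incidentToLoop_head hΓ hl fun e he hpos ↦ by
    rw [key] at q₁ q₂
    rcases hall e he with rfl | rfl | rfl | rfl | rfl | rfl
    all_goals first | exact Or.inl rfl | exact Or.inr rfl | linarith
  have hE₁ := hE.incidentToLoop_head hΓ hl.rev fun e he hpos ↦ by
    rw [key] at hpos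
    rcases hall e (he.trans hl) with rfl | rfl | rfl | rfl | rfl | rfl
    all_goals first | exact Or.inl rfl | exact Or.inr rfl | linarith
  rcases hall d hv.symm with rfl | rfl | rfl | rfl | rfl | rfl
  · exact ⟨d, hl, hl.symm⟩
  · exact ⟨ℓ, hl, by rw [G.head_rev]⟩
  · exact hD₁
  · rwa [G.head_rev, hD.tail₂]
  · exact hE₁
  · rwa [G.head_rev, hE.tail₂]

end Loops

/-! ### Connectedness of the graph. -/

section Connected

variable (Γ) in
/-- The union of the vertices in `S` and the edges whose tail is in `S`. -/
def subdrawing (S : Set V) : Set FlatTorus :=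
  Γ.pos '' S ∪ ⋃ d ∈ {d | G.tail d ∈ S}, Γ.edgePoint d '' Set.Icc (0 : ℝ) 1

variable (Γ) in
/-- The union of the closed faces with vertices in `S`. -/
def faceUnion (S : Set V) : Set FlatTorus :=
  ⋃ f ∈ {f : D × D × D | Γ.LeftFace f.1 f.2.1 f.2.2 ∧ G.tail f.1 ∈ S},
    (fun x ↦ Γ.pos (G.tail f.1) + torusProj x) '' closedTri 0 (Γ.disp f.1) (-Γ.disp f.2.2)

theorem isCompact_subdrawing [Finite V] [Finite D] (S : Set V) : IsCompact (Γ.subdrawing S) :=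
  (S.toFinite.image _).isCompact.union <| (Set.toFinite _).isCompact_biUnion fun d _ ↦
    isCompact_Icc.image (continuous_edgePoint d)

theorem isCompact_faceUnion [Finite D] (S : Set V) : IsCompact (Γ.faceUnion S) :=
  (Set.toFinite _).isCompact_biUnion fun _ _ ↦
    (isCompact_closedTri _ _ _).image (continuous_const.add continuous_torusProj)

theorem subdrawing_subset_image (S : Set V) : Γ.subdrawing S ⊆ Γ.image :=
  Set.union_subset_union (Set.image_subset_range _ _)
    (Set.iUnion₂_subset fun d _ ↦ Set.subset_iUnion_of_subset d subset_rfl)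

theorem edgePoint_mem_subdrawing {S : Set V} {d : D} (hd : G.tail d ∈ S) {t : ℝ}
    (ht : t ∈ Set.Icc (0 : ℝ) 1) : Γ.edgePoint d t ∈ Γ.subdrawing S :=
  Or.inr (Set.mem_biUnion (x := d) hd ⟨t, ht, rfl⟩)

theorem mem_faceUnion {S : Set V} {y : FlatTorus} : y ∈ Γ.faceUnion S ↔
    ∃ d₀ d₁ d₂, Γ.LeftFace d₀ d₁ d₂ ∧ G.tail d₀ ∈ S ∧
      ∃ x ∈ closedTri 0 (Γ.disp d₀) (-Γ.disp d₂), y = Γ.pos (G.tail d₀) + torusProj x := by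
  simp only [faceUnion, Set.mem_iUnion, Set.mem_image]
  constructor
  · rintro ⟨⟨d₀, d₁, d₂⟩, ⟨h, hS⟩, x, hx, rfl⟩
    exact ⟨d₀, d₁, d₂, h, hS, x, hx, rfl⟩
  · rintro ⟨d₀, d₁, d₂, h, hS, x, hx, rfl⟩
    exact ⟨⟨d₀, d₁, d₂⟩, ⟨h, hS⟩, x, hx, rfl⟩

theorem mem_closedTri_zero_iff {a p q z : ℝ × ℝ} :
    z ∈ closedTri a p q ↔ z - a ∈ closedTri 0 p q := by
  simp only [closedTri, Set.mem_ofPred_eq, zero_add, sub_eq_iff_eq_add']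

theorem subdrawing_disjoint (hΓ : Γ.IsEmbedding) {S T : Set V} (hST : Disjoint S T)
    (hS : ∀ d, G.tail d ∈ S → G.head d ∈ S) (hT : ∀ d, G.tail d ∈ T → G.head d ∈ T) :
    Disjoint (Γ.subdrawing S) (Γ.subdrawing T) := by
  -- Every point of a part is a vertex of it or in the relative interior of an edge of it.
  have split : ∀ {S : Set V}, (∀ d, G.tail d ∈ S → G.head d ∈ S) → ∀ {y}, y ∈ Γ.subdrawing S →
      (∃ v ∈ S, y = Γ.pos v) ∨
        ∃ d t, G.tail d ∈ S ∧ t ∈ Set.Ioo (0 : ℝ) 1 ∧ y = Γ.edgePoint d t := by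
    intro S hS y hy
    rcases hy with ⟨v, hv, rfl⟩ | hy
    · exact Or.inl ⟨v, hv, rfl⟩
    · obtain ⟨d, hd, t, ht, rfl⟩ := Set.mem_iUnion₂.1 hy
      rcases ht.1.eq_or_lt with rfl | h0
      · exact Or.inl ⟨_, hd, edgePoint_zero d⟩
      rcases ht.2.eq_or_lt with rfl | h1
      · exact Or.inl ⟨_, hS d hd, edgePoint_one d⟩
      exact Or.inr ⟨d, t, hd, ⟨h0, h1⟩, rfl⟩
  refine Set.disjoint_left.2 fun y hyS hyT ↦ ?_
  rcases split hS hyS with ⟨v, hv, rfl⟩ | ⟨d, t, hd, ht, rfl⟩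
  · rcases split hT hyT with ⟨w, hw, h⟩ | ⟨e, r, he, hr, h⟩
    · exact hST.le_bot ⟨hv, hΓ.pos_injective h ▸ hw⟩
    · exact hΓ.edge_ne_pos e r hr v h.symm
  · rcases split hT hyT with ⟨w, hw, h⟩ | ⟨e, r, he, hr, h⟩
    · exact hΓ.edge_ne_pos d t ht w h
    · rcases hΓ.edge_injective d e t ht r hr h with ⟨rfl, -⟩ | ⟨rfl, -⟩
      · exact hST.le_bot ⟨hd, he⟩
      · exact hST.le_bot ⟨hS d hd, he⟩

theorem LeftFace.mem_subdrawing {d₀ d₁ d₂ : D} (h : Γ.LeftFace d₀ d₁ d₂) {S : Set V}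
    (hS : ∀ d, G.tail d ∈ S → G.head d ∈ S) (hd : G.tail d₀ ∈ S) {a : ℝ × ℝ}
    (ha : torusProj a = Γ.pos (G.tail d₀)) {z : ℝ × ℝ}
    (hz : z ∈ closedTri a (Γ.disp d₀) (-Γ.disp d₂))
    (hz' : z ∉ openTri a (Γ.disp d₀) (-Γ.disp d₂)) : torusProj z ∈ Γ.subdrawing S := by
  have h₁ : G.tail d₁ ∈ S := h.tail₁ ▸ hS _ hd
  have h₂ : G.tail d₂ ∈ S := h.tail₂ ▸ hS _ h₁
  obtain ⟨r, hr, ⟨-, h⟩ | ⟨-, h⟩ | ⟨-, h⟩⟩ := h.exists_edgePoint ha hz hz' <;> rw [h]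
  exacts [edgePoint_mem_subdrawing hd hr, edgePoint_mem_subdrawing h₁ hr,
    edgePoint_mem_subdrawing h₂ hr]

theorem mem_subdrawing_of_mem_faceUnion {S : Set V} (hS : ∀ d, G.tail d ∈ S → G.head d ∈ S)
    {y : FlatTorus} (hy : y ∈ Γ.faceUnion S) (hyi : y ∈ Γ.image) : y ∈ Γ.subdrawing S := by
  obtain ⟨d₀, d₁, d₂, h, hd, x, hx, rfl⟩ := mem_faceUnion.1 hy
  obtain ⟨a, ha⟩ := torusProj_surjective (Γ.pos (G.tail d₀))
  rw [← ha, ← torusProj_add] at hyi ⊢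
  exact h.mem_subdrawing hS hd ha (mem_closedTri_zero_iff.2 (by rwa [add_sub_cancel_left]))
    fun h' ↦ h.disjoint_coverImage ha h' hyi

/-- Faces that belong to different parts of the drawing can meet only in the drawing. -/
theorem faceUnion_inter_subset (hΓ : Γ.IsEmbedding) {S T : Set V} (hST : Disjoint S T)
    (hS : ∀ d, G.tail d ∈ S → G.head d ∈ S) (hT : ∀ d, G.tail d ∈ T → G.head d ∈ T) :
    Γ.faceUnion S ∩ Γ.faceUnion T ⊆ Γ.image := by
  rintro y ⟨hyS, hyT⟩
  by_contra hy
  obtain ⟨d₀, d₁, d₂, hF, hd, x, hx, rfl⟩ := mem_faceUnion.1 hyS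
  obtain ⟨e₀, e₁, e₂, hF', he, x', hx', hxx⟩ := mem_faceUnion.1 hyT
  obtain ⟨a, ha⟩ := torusProj_surjective (Γ.pos (G.tail d₀))
  -- This choice makes both lifted triangles contain the same lift `a + x` of the common point.
  set b := a + x - x' with hb'
  have hb : torusProj b = Γ.pos (G.tail e₀) := by
    rw [hb', torusProj_sub, torusProj_add, ha, hxx, add_sub_cancel_right]
  rw [← ha, ← torusProj_add] at hy
  have hopen : ∀ {c p q : ℝ × ℝ}, a + x - c ∈ closedTri 0 p q → a + x ∈ closedTri c p q :=
    fun h ↦ mem_closedTri_zero_iff.2 h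
  have m₁ : a + x ∈ openTri a (Γ.disp d₀) (-Γ.disp d₂) := by
    by_contra h
    exact hy (subdrawing_subset_image S (hF.mem_subdrawing hS hd ha
      (hopen (by rwa [add_sub_cancel_left])) h))
  have m₂ : a + x ∈ openTri b (Γ.disp e₀) (-Γ.disp e₂) := by
    by_contra h
    exact hy (subdrawing_subset_image T (hF'.mem_subdrawing hT he hb
      (hopen (by rwa [hb', sub_sub_cancel])) h))
  have det' : planeDet (Γ.disp e₀) (-Γ.disp e₂) ≠ 0 := by
    rw [← Γ.disp_rev]
    exact hF'.planeDet_rev.ne'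
  have hclosed := (isCompact_closedTri b (Γ.disp e₀) (-Γ.disp e₂)).isClosed
  -- The first open triangle is connected and misses the sides of the second, so it stays inside.
  -- Its corner `a` then lies in the second closed triangle, hence on the part of the drawing over
  -- `T`, though it belongs to the part over `S`.
  have hsub : openTri a (Γ.disp d₀) (-Γ.disp d₂) ⊆ openTri b (Γ.disp e₀) (-Γ.disp e₂) := by
    refine (convex_openTri _ _ _).isPreconnected.subset_left_of_subset_union (isOpen_openTri det')
      hclosed.isOpen_compl ?_ ?_ ⟨_, m₁, m₂⟩
    · exact Set.disjoint_compl_right_iff_subset.2 (openTri_subset_closedTri _ _ _)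
    · intro z hz
      by_contra h
      rw [Set.mem_union, not_or, Set.notMem_compl_iff] at h
      exact hF.disjoint_coverImage ha hz
        (subdrawing_subset_image T (hF'.mem_subdrawing hT he hb h.2 h.1))
  have hacl : a ∈ closedTri b (Γ.disp e₀) (-Γ.disp e₂) :=
    closure_minimal (hsub.trans (openTri_subset_closedTri _ _ _)) hclosed
      (left_mem_closure_openTri _ _ _)
  have hai : torusProj a ∈ Γ.subdrawing S := by
    rw [ha]
    exact Or.inl ⟨_, hd, rfl⟩
  refine Set.disjoint_left.1 (subdrawing_disjoint hΓ hST hS hT) hai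
    (hF'.mem_subdrawing hT he hb hacl fun h ↦ ?_)
  exact hF'.disjoint_coverImage hb h (subdrawing_subset_image S hai)

/-- The graph of a toroidal triangulation is connected. -/
theorem IsTriangulation.mem_of_forall_head_mem [Finite V] [Finite D] (hΓ : Γ.IsTriangulation)
    {S : Set V} (hS : ∀ d, G.tail d ∈ S → G.head d ∈ S) {v : V} (hv : v ∈ S) (w : V) : w ∈ S := by
  by_contra hw
  have hT : ∀ d, G.tail d ∈ Sᶜ → G.head d ∈ Sᶜ := fun d hd hd' ↦
    hd (by simpa only [G.head_rev] using hS (G.rev d) hd')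
  have hdisj := subdrawing_disjoint hΓ.toIsEmbedding disjoint_compl_right hS hT
  have hcover : ∀ y, y ∈ (Γ.subdrawing S ∪ Γ.faceUnion S) ∪
      (Γ.subdrawing Sᶜ ∪ Γ.faceUnion Sᶜ) := by
    intro y
    by_cases hy : y ∈ Γ.image
    · rcases hy with ⟨u, rfl⟩ | hy
      · by_cases hu : u ∈ S
        · exact Or.inl (Or.inl (Or.inl ⟨u, hu, rfl⟩))
        · exact Or.inr (Or.inl (Or.inl ⟨u, hu, rfl⟩))
      · obtain ⟨d, t, ht, rfl⟩ := Set.mem_iUnion.1 hy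
        by_cases hd : G.tail d ∈ S
        · exact Or.inl (Or.inl (edgePoint_mem_subdrawing hd ht))
        · exact Or.inr (Or.inl (edgePoint_mem_subdrawing hd ht))
    · obtain ⟨z, rfl⟩ := torusProj_surjective y
      obtain ⟨d₀, d₁, d₂, a, hF, ha, hC⟩ := hΓ.exists_leftFace_of_notMem (z := z) hy
      have hz : z ∈ openTri a (Γ.disp d₀) (-Γ.disp d₂) := by
        rw [← hC]
        exact mem_connectedComponentIn hy
      have hz' := mem_closedTri_zero_iff.1 (openTri_subset_closedTri _ _ _ hz)
      have hza : torusProj z = Γ.pos (G.tail d₀) + torusProj (z - a) := by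
        rw [← ha, ← torusProj_add, add_sub_cancel]
      by_cases hd : G.tail d₀ ∈ S
      · exact Or.inl (Or.inr (mem_faceUnion.2 ⟨d₀, d₁, d₂, hF, hd, _, hz', hza⟩))
      · exact Or.inr (Or.inr (mem_faceUnion.2 ⟨d₀, d₁, d₂, hF, hd, _, hz', hza⟩))
  have hclosed : ∀ S : Set V, IsClosed (Γ.subdrawing S ∪ Γ.faceUnion S) := fun S ↦
    ((isCompact_subdrawing S).union (isCompact_faceUnion S)).isClosed
  -- Two nonempty closed sets covering the connected torus must meet. A common point would lie on
  -- both disjoint parts of the drawing.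
  obtain ⟨y, -, hyS, hyT⟩ := isPreconnected_closed_iff.1 (isPreconnected_univ (α := FlatTorus))
    _ _ (hclosed S) (hclosed Sᶜ) (fun y _ ↦ hcover y)
    ⟨Γ.pos v, trivial, Or.inl (Or.inl ⟨v, hv, rfl⟩)⟩
    ⟨Γ.pos w, trivial, Or.inl (Or.inl ⟨w, hw, rfl⟩)⟩
  have hyi : y ∈ Γ.image := by
    rcases hyS with h | h
    · exact subdrawing_subset_image _ h
    rcases hyT with h' | h'
    · exact subdrawing_subset_image _ h'
    · exact faceUnion_inter_subset hΓ.toIsEmbedding disjoint_compl_right hS hT ⟨h, h'⟩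
  exact Set.disjoint_left.1 hdisj
    (hyS.elim id fun h ↦ mem_subdrawing_of_mem_faceUnion hS h hyi)
    (hyT.elim id fun h ↦ mem_subdrawing_of_mem_faceUnion hT h hyi)

end Connected

/-! ### Counting darts with a generic height. -/

section Counting

/-- The number `c` avoids the finitely many slopes. A vertical edge contributes the junk slope 0,
which only excludes one more value. -/
theorem exists_forall_height_ne_zero [Finite D] (hΓ : Γ.IsEmbedding) :
    ∃ c : ℝ, ∀ d, (Γ.disp d).2 - c * (Γ.disp d).1 ≠ 0 := by
  obtain ⟨c, hc⟩ := (Set.finite_range fun d ↦ (Γ.disp d).2 / (Γ.disp d).1).exists_notMem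
  refine ⟨c, fun d h ↦ ?_⟩
  by_cases h1 : (Γ.disp d).1 = 0
  · exact hΓ.disp_ne_zero d (Prod.ext h1 (by simpa [h1] using h))
  · exact hc ⟨d, by field_simp; linarith⟩

/-- A toroidal triangulation has at most three edges per vertex: every face has a corner that is
neither its highest nor its lowest, and every vertex is such a corner at most twice. -/
theorem IsTriangulation.card_dart_le [Finite V] [Finite D] (hΓ : Γ.IsTriangulation) :
    Nat.card D ≤ 6 * Nat.card V := by
  classical
  have hE := hΓ.toIsEmbedding
  obtain ⟨c, hc⟩ := exists_forall_height_ne_zero hE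
  choose next prev hF using hΓ.exists_leftFace
  set h : D → ℝ := fun d ↦ (Γ.disp d).2 - c * (Γ.disp d).1 with hh
  have hprev : ∀ d, prev (next d) = d := fun d ↦ (hE.leftFace_unique (hF d).rotate (hF _)).2
  have hnext : ∀ d, next (next d) = prev d := fun d ↦
    (hE.leftFace_unique (hF d).rotate (hF _)).1
  have hsum : ∀ d, h d + h (next d) + h (prev d) = 0 := fun d ↦ by
    have e1 := congrArg Prod.fst (hF d).sum_disp
    have e2 := congrArg Prod.snd (hF d).sum_disp
    simp only [Prod.fst_add, Prod.snd_add, Prod.fst_zero, Prod.snd_zero] at e1 e2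
    simp only [hh]
    linear_combination e2 - c * e1
  -- The face left of `d` arrives at the tail of `d` along `prev d` and leaves along `d`. Equal
  -- signs mean that this corner is its middle one.
  let M : Set D := {d | 0 < h d * h (prev d)}
  -- Two of three nonzero heights have the same sign, and any two sides of a triangle are
  -- consecutive.
  have hcov : (Set.univ : Set D) ⊆ (M ∪ prev '' M) ∪ next '' M := by
    intro d _
    have h0 := hc d
    have h1 := hc (next d)
    have h2 := hc (prev d)
    change h d ≠ 0 at h0
    change h (next d) ≠ 0 at h1
    change h (prev d) ≠ 0 at h2
    have hs := hsum d
    have hnp : next (prev d) = d := by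
      rw [← hnext, hnext (next d), hprev]
    have hpp : prev (prev d) = next d := by
      rw [← hnext d, hprev]
    by_cases m0 : d ∈ M
    · exact Or.inl (Or.inl m0)
    by_cases m1 : next d ∈ M
    · exact Or.inl (Or.inr ⟨_, m1, hprev d⟩)
    refine Or.inr ⟨prev d, ?_, hnp⟩
    simp only [M, Set.mem_ofPred_eq, hprev, hpp] at m0 m1 ⊢
    rcases h0.lt_or_gt with a0 | a0 <;> rcases h1.lt_or_gt with a1 | a1 <;>
      rcases h2.lt_or_gt with a2 | a2 <;>
      first
      | linarith
      | exact absurd (mul_pos_of_neg_of_neg a0 a2) m0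
      | exact absurd (mul_pos a0 a2) m0
      | exact absurd (mul_pos_of_neg_of_neg a1 a0) m1
      | exact absurd (mul_pos a1 a0) m1
      | exact mul_pos a2 a1
      | exact mul_pos_of_neg_of_neg a2 a1
  -- A middle corner contains the level direction `-(1, c)` if `h d` is positive and `(1, c)` if it
  -- is negative. At a given vertex only one corner contains each.
  have hinj : Set.InjOn (fun d ↦ (G.tail d, decide (0 < h d))) M := by
    have key : ∀ d d', d ∈ M → d' ∈ M → G.tail d' = G.tail d → 0 < h d * h d' →
        0 < planeDet (Γ.disp d) (Γ.disp d') → False := by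
      intro d d' hd hd' ht hdd hdet
      refine (hF d).false_of_between ht hdet ?_
      have hp := (hF d).planeDet_rev
      set f := G.rev (prev d)
      have hf : h f = -h (prev d) := by simp only [hh, f, Γ.disp_rev]; simp; ring
      have hd : 0 < h d * h (prev d) := hd
      have plucker : h d * planeDet (Γ.disp d') (Γ.disp f) =
          h d' * planeDet (Γ.disp d) (Γ.disp f) +
            h (prev d) * planeDet (Γ.disp d) (Γ.disp d') := by
        rw [show h (prev d) = -h f by rw [hf, neg_neg]]
        simp only [hh, planeDet]; ring
      have hsq : 0 < h d * h d := mul_self_pos.2 (hc d)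
      refine pos_of_mul_pos_right ?_ hsq.le
      rw [mul_assoc, plucker, mul_add, ← mul_assoc, ← mul_assoc]
      positivity
    intro d hd d' hd' hdd
    simp only [Prod.mk.injEq, decide_eq_decide] at hdd
    obtain ⟨ht, hs⟩ := hdd
    have hprod : 0 < h d * h d' := by
      rcases lt_or_gt_of_ne (hc d) with a | a
      · exact mul_pos_of_neg_of_neg a
          (lt_of_le_of_ne (not_lt.1 fun b ↦ lt_asymm a (hs.2 b)) (hc d'))
      · exact mul_pos a (hs.1 a)
    rcases lt_trichotomy (planeDet (Γ.disp d) (Γ.disp d')) 0 with hlt | heq | hgt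
    · refine (key d' d hd' hd ht (by rwa [mul_comm]) ?_).elim
      unfold planeDet at *
      linarith
    · have hval : ∀ (r : ℝ) (x : D), planeDet (r • ((1 : ℝ), c)) (Γ.disp x) = r * h x :=
        fun r x ↦ by simp [planeDet, hh]; ring
      exact (hE.eq_of_planeDet_eq_zero ht.symm heq (c := h d • ((1 : ℝ), c))
        (by rw [hval]; exact mul_self_pos.2 (hc d)) (by rwa [hval])).symm
    · exact (key d d' hd hd' ht.symm hprod hgt).elim
  have hM : M.ncard ≤ 2 * Nat.card V := by
    have := Set.ncard_le_ncard_of_injOn (t := Set.univ) _ (fun _ _ ↦ Set.mem_univ _) hinj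
    rw [Set.ncard_univ, Nat.card_prod] at this
    simpa [mul_comm] using this
  have h1 := Set.ncard_le_ncard hcov
  rw [Set.ncard_univ] at h1
  have h2 := Set.ncard_union_le (M ∪ prev '' M) (next '' M)
  have h3 := Set.ncard_union_le M (prev '' M)
  have h4 := Set.ncard_image_le (f := prev) M.toFinite
  have h5 := Set.ncard_image_le (f := next) M.toFinite
  omega

theorem _root_.DartGraph.sum_degree [Fintype V] [Finite D] (G : DartGraph V D) :
    ∑ v, G.degree v = Nat.card D := by
  classical
  have := Fintype.ofFinite D
  rw [Nat.card_eq_fintype_card, ← Finset.card_univ,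
    Finset.card_eq_sum_card_fiberwise (f := G.tail) (t := Finset.univ) (by simp)]
  refine Finset.sum_congr rfl fun v _ ↦ ?_
  rw [DartGraph.degree, ← Set.ncard_coe_finset]
  simp

/-- The average degree is at most 6, so a lower bound of 6 is attained everywhere. -/
theorem IsTriangulation.degree_eq_six [Finite V] [Finite D] (hΓ : Γ.IsTriangulation)
    (h : ∀ v, 6 ≤ G.degree v) (v : V) : G.degree v = 6 := by
  have := Fintype.ofFinite V
  have hle := hΓ.card_dart_le
  rw [← G.sum_degree, Nat.card_eq_fintype_card] at hle
  have hsum : ∑ _v : V, 6 = ∑ v, G.degree v :=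
    le_antisymm (Finset.sum_le_sum fun v _ ↦ h v) (by simpa [mul_comm] using hle)
  exact ((Finset.sum_eq_sum_iff_of_le fun v _ ↦ h v).1 hsum v (Finset.mem_univ v)).symm

end Counting

/-! ### Conclusion. -/

theorem IsTriangulation.isZipper [Finite V] [Finite D] (hΓ : Γ.IsTriangulation)
    (hdeg : ∀ v, G.degree v = 6) (hG : G.HasLoop) : Γ.IsZipper := by
  obtain ⟨ℓ, hl⟩ := hG
  exact ⟨hΓ, hΓ.mem_of_forall_head_mem (S := {v | G.IncidentToLoop v})
    (fun d hd ↦ incidentToLoop_head_of_degree_eq_six hΓ (hdeg _) hd) ⟨ℓ, hl, rfl⟩⟩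

end GeodesicDrawing

theorem lemmaL {V D : Type*} [Finite V] [Finite D] (G : DartGraph V D)
    (Γ : GeodesicDrawing G) (hΓ : Γ.IsTriangulation) :
    ((∀ v, G.degree v = 6) → G.HasLoop → Γ.IsZipper) ∧
    (∀ v, G.IncidentToLoop v → 6 ≤ G.degree v) ∧
    (¬ Γ.IsZipper → G.HasLoop → ∃ v, G.degree v ≤ 5 ∧ ¬ G.IncidentToLoop v) := by
  refine ⟨hΓ.isZipper, fun v hv ↦ GeodesicDrawing.six_le_degree hΓ hv, fun hz hG ↦ ?_⟩
  -- Now every vertex of degree at most 5 has a loop, hence degree at least 6, so no such vertex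
  -- exists.
  by_contra! h
  refine hz (hΓ.isZipper (hΓ.degree_eq_six fun v ↦ ?_) hG)
  by_contra hv
  exact hv (GeodesicDrawing.six_le_degree hΓ (h v (by omega)))
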